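/- Let $\mathbb{N}=\{1,2,3,\ldots\}$ and let $\mathbb{K}$ be $\mathbb{R}$ or $\mathbb{C}$. For non-empty finite sets $E,F\subseteq\mathbb{N}$ write $E<F$ if $\max E<\min F$. Define families $\mathcal{S}_n$ of finite subsets of $\mathbb{N}$ by $\mathcal{S}_0=\{\{k\}:k\in\mathbb{N}\}\cup\{\emptyset\}$ and, for $n\geqslant 0$, \[ \mathcal{S}_{n+1}=\Bigl\{\bigcup_{i=1}^k E_i : k\in\mathbb{N},\ E_1,\ldots,E_k\in\mathcal{S}_n\setminus\{\emptyset\},\ k\leqslant\min E_1,\ E_1<E_2<\cdots<E_k\Bigr\}\cup\{\emptyset\}. \] Let $c_{00}$ be the space of finitely supported sequences $(\alpha_j)_{j\in\mathbb{N}}$ in $\mathbb{K}$. The Schreier space $X[\mathcal{S}_n]$ of order $n$ is the completion of $c_{00}$ with respect to the norm \[ \|(\alpha_j)\|=\sup\Bigl\{\sum_{j\in E}|\alpha_j| : E\in\mathcal{S}_n\setminus\{\emptyset\}\Bigr\}; \] $(e_j)_{j\in\mathbb{N}}$ denotes its unit vector basis, and for $M\subseteq\mathbb{N}$, $X_M=\overline{\operatorname{span}}\{e_j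 : j\in M\}$. Proposition. Let $X=X[\mathcal{S}_n]$ for some $n\geqslant 1$. Then, for every infinite set $M\subseteq\mathbb{N}$, the space $X_M$ is isomorphic, via a bounded $\mathbb{K}$-linear bijection with bounded inverse, to $X_M\oplus X_M$. -/

import Mathlib

/-- For finite sets of positive integers, `E < F`: every element of `E` is smaller than every
element of `F`. -/
def Successive (E F : Finset ℕ+) : Prop :=
  ∀ a ∈ E, ∀ b ∈ F, a < b

/-- The Schreier families `𝓢₀, 𝓢₁, 𝓢₂, …` of finite subsets of `{1, 2, 3, …}`. A nonempty set of
`𝓢ₙ₊₁` is a union of `k ≥ 1` nonempty sets `F 0 < F 1 < ⋯ < F (k - 1)` of `𝓢ₙ` such that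
`k ≤ min (F 0)`. -/
def schreierFamily : ℕ → Set (Finset ℕ+)
  | 0 => {E | E = ∅ ∨ ∃ k : ℕ+, E = {k}}
  | n + 1 => {E | E = ∅ ∨ ∃ (k : ℕ) (F : ℕ → Finset ℕ+), 0 < k ∧
      (∀ i < k, F i ∈ schreierFamily n ∧ (F i).Nonempty) ∧
      (∀ i, i + 1 < k → Successive (F i) (F (i + 1))) ∧
      (∀ a ∈ F 0, k ≤ (a : ℕ)) ∧
      E = (Finset.range k).biUnion F}

theorem singleton_mem_schreierFamily (n : ℕ) (j : ℕ+) : {j} ∈ schreierFamily n := by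
  induction n with
  | zero => exact Or.inr ⟨j, rfl⟩
  | succ n ih =>
    refine Or.inr ⟨1, fun _ => {j}, one_pos, fun _ _ => ⟨ih, by simp⟩, fun i hi => by omega,
      fun a _ => a.pos, by simp⟩

/-- The nonempty sets of `𝓢ₙ`. -/
abbrev SchreierSet (n : ℕ) : Type :=
  {E : Finset ℕ+ // E ∈ schreierFamily n ∧ E.Nonempty}

instance (n : ℕ) : Nonempty (SchreierSet n) :=
  ⟨⟨{1}, singleton_mem_schreierFamily n 1, by simp⟩⟩

/-- The vector space `c₀₀` of finitely supported scalar sequences `(α₁, α₂, …)`, as a type of its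
own for each order `n`, to carry the `n`-th Schreier norm. -/
def SchreierC00 (𝕜 : Type*) [RCLike 𝕜] (_n : ℕ) : Type _ := ℕ+ →₀ 𝕜

namespace SchreierC00

noncomputable instance instAddCommGroup (𝕜 : Type*) [RCLike 𝕜] (n : ℕ) :
    AddCommGroup (SchreierC00 𝕜 n) :=
  inferInstanceAs (AddCommGroup (ℕ+ →₀ 𝕜))

noncomputable instance instModule (𝕜 : Type*) [RCLike 𝕜] (n : ℕ) : Module 𝕜 (SchreierC00 𝕜 n) :=
  inferInstanceAs (Module 𝕜 (ℕ+ →₀ 𝕜))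

/-- The identity map from `c₀₀` with its Schreier norm to the plain space of finitely supported
sequences. -/
noncomputable def toFinsupp {𝕜 : Type*} [RCLike 𝕜] {n : ℕ} : SchreierC00 𝕜 n ≃ₗ[𝕜] (ℕ+ →₀ 𝕜) :=
  LinearEquiv.refl 𝕜 (ℕ+ →₀ 𝕜)

/-- The `j`-th coordinate of a finitely supported sequence. -/
noncomputable def coord {𝕜 : Type*} [RCLike 𝕜] {n : ℕ} (x : SchreierC00 𝕜 n) (j : ℕ+) : 𝕜 :=
  toFinsupp x j

/-- The unit vectors of `c₀₀`. -/
noncomputable def unit (𝕜 : Type*) [RCLike 𝕜] (n : ℕ) (j : ℕ+) : SchreierC00 𝕜 n :=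
  toFinsupp.symm (Finsupp.single j 1)

/-- The Schreier norm of order `n`: the supremum of `∑ j ∈ E, |αⱼ|` over the nonempty `E ∈ 𝓢ₙ`. -/
noncomputable def schreierNorm {𝕜 : Type*} [RCLike 𝕜] {n : ℕ} (x : SchreierC00 𝕜 n) : ℝ :=
  ⨆ E : SchreierSet n, ∑ j ∈ E.1, ‖x.coord j‖

theorem bddAbove {𝕜 : Type*} [RCLike 𝕜] {n : ℕ} (x : SchreierC00 𝕜 n) :
    BddAbove (Set.range fun E : SchreierSet n => ∑ j ∈ E.1, ‖x.coord j‖) := by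
  classical
  refine ⟨∑ j ∈ (toFinsupp x).support, ‖x.coord j‖, ?_⟩
  rintro _ ⟨E, rfl⟩
  have h : ∑ j ∈ E.1, ‖x.coord j‖
      = ∑ j ∈ E.1.filter (fun j => j ∈ (toFinsupp x).support), ‖x.coord j‖ :=
    (Finset.sum_filter_of_ne fun j _ hj =>
      Finsupp.mem_support_iff.2 fun h => hj (norm_eq_zero.2 h)).symm
  exact h.trans_le (Finset.sum_le_sum_of_subset_of_nonneg
    (fun j hj => (Finset.mem_filter.1 hj).2) fun _ _ _ => norm_nonneg _)

theorem sum_le_schreierNorm {𝕜 : Type*} [RCLike 𝕜] {n : ℕ} (x : SchreierC00 𝕜 n)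
    (E : SchreierSet n) : ∑ j ∈ E.1, ‖x.coord j‖ ≤ x.schreierNorm :=
  le_ciSup x.bddAbove E

theorem schreierNorm_zero {𝕜 : Type*} [RCLike 𝕜] {n : ℕ} :
    (0 : SchreierC00 𝕜 n).schreierNorm = 0 := by
  have h : ∀ j, (0 : SchreierC00 𝕜 n).coord j = 0 := fun j => by simp [coord]
  simp [schreierNorm, h]

theorem schreierNorm_neg {𝕜 : Type*} [RCLike 𝕜] {n : ℕ} (x : SchreierC00 𝕜 n) :
    (-x).schreierNorm = x.schreierNorm := by
  have h : ∀ j, (-x).coord j = -x.coord j := fun j => by simp [coord]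
  simp [schreierNorm, h]

theorem schreierNorm_add_le {𝕜 : Type*} [RCLike 𝕜] {n : ℕ} (x y : SchreierC00 𝕜 n) :
    (x + y).schreierNorm ≤ x.schreierNorm + y.schreierNorm := by
  refine ciSup_le fun E => ?_
  calc ∑ j ∈ E.1, ‖(x + y).coord j‖
      ≤ ∑ j ∈ E.1, (‖x.coord j‖ + ‖y.coord j‖) :=
        Finset.sum_le_sum fun j _ => by
          simpa [coord] using norm_add_le (x.coord j) (y.coord j)
    _ = ∑ j ∈ E.1, ‖x.coord j‖ + ∑ j ∈ E.1, ‖y.coord j‖ := Finset.sum_add_distrib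
    _ ≤ _ := add_le_add (x.sum_le_schreierNorm E) (y.sum_le_schreierNorm E)

theorem eq_zero_of_schreierNorm_eq_zero {𝕜 : Type*} [RCLike 𝕜] {n : ℕ} (x : SchreierC00 𝕜 n)
    (hx : x.schreierNorm = 0) : x = 0 := by
  refine toFinsupp.injective (Finsupp.ext fun j => ?_)
  have h := x.sum_le_schreierNorm ⟨{j}, singleton_mem_schreierFamily n j, by simp⟩
  rw [hx, Finset.sum_singleton] at h
  simpa [coord] using h

theorem schreierNorm_smul {𝕜 : Type*} [RCLike 𝕜] {n : ℕ} (c : 𝕜) (x : SchreierC00 𝕜 n) :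
    (c • x).schreierNorm = ‖c‖ * x.schreierNorm := by
  have h : ∀ j, (c • x).coord j = c * x.coord j := fun j => by simp [coord]
  simp only [schreierNorm, h, norm_mul, ← Finset.mul_sum]
  exact (Real.mul_iSup_of_nonneg (norm_nonneg c) _).symm

noncomputable instance instNormedAddCommGroup (𝕜 : Type*) [RCLike 𝕜] (n : ℕ) :
    NormedAddCommGroup (SchreierC00 𝕜 n) :=
  AddGroupNorm.toNormedAddCommGroup
    { toFun := schreierNorm
      map_zero' := schreierNorm_zero
      add_le' := schreierNorm_add_le
      neg' := schreierNorm_neg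
      eq_zero_of_map_eq_zero' := eq_zero_of_schreierNorm_eq_zero }

theorem norm_def {𝕜 : Type*} [RCLike 𝕜] {n : ℕ} (x : SchreierC00 𝕜 n) :
    ‖x‖ = ⨆ E : SchreierSet n, ∑ j ∈ E.1, ‖x.coord j‖ := rfl

noncomputable instance instNormedSpace (𝕜 : Type*) [RCLike 𝕜] (n : ℕ) :
    NormedSpace 𝕜 (SchreierC00 𝕜 n) where
  norm_smul_le c x := (schreierNorm_smul c x).le

end SchreierC00

/-- The Schreier space `X[𝓢ₙ]` of order `n`: the completion of `c₀₀` in the Schreier norm. -/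
abbrev SchreierSpace (𝕜 : Type*) [RCLike 𝕜] (n : ℕ) : Type _ :=
  UniformSpace.Completion (SchreierC00 𝕜 n)

/-- The unit vector basis `(eⱼ)` of `X[𝓢ₙ]`. -/
noncomputable def schreierBasis (𝕜 : Type*) [RCLike 𝕜] (n : ℕ) (j : ℕ+) : SchreierSpace 𝕜 n :=
  (SchreierC00.unit 𝕜 n j : UniformSpace.Completion (SchreierC00 𝕜 n))

/-- The closed subspace `X_M` of `X = X[𝓢ₙ]` spanned by the basis vectors `eⱼ` with `j ∈ M`. -/
noncomputable def schreierSubspace (𝕜 : Type*) [RCLike 𝕜] (n : ℕ) (M : Set ℕ+) :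
    Submodule 𝕜 (SchreierSpace 𝕜 n) :=
  (Submodule.span 𝕜 (schreierBasis 𝕜 n '' M)).topologicalClosure

/-! Enumerate `M` increasingly by `φ`, and interleave two finitely supported sequences, placing one
at even and the other at odd indices. This is a linear bijection; the point is that it is bounded
both ways for the norms along `(e_{φ j})`.

Recovering either half costs nothing, because the Schreier families are hereditary and spreading.
The other direction needs `(e_{φ (2j)})` to be dominated by `(e_{φ j})`. This is
`exists_cover_of_map_double`: if `{φ (2j) : j ∈ F}` is in `𝓢ₙ`, then `φ(F)` is a union of at most `n
+ 1` sets of `𝓢ₙ`, whence the constant `n + 1`. Odd indices are dominated by even ones by spreading.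
Density and completeness extend the isomorphism to the closed spans. -/

namespace SchreierFamily

/-! ### Hereditary and spreading properties of the Schreier families -/

theorem mem_zero_iff {E : Finset ℕ+} : E ∈ schreierFamily 0 ↔ E.card ≤ 1 := by
  rw [Nat.le_one_iff_eq_zero_or_eq_one, Finset.card_eq_zero, Finset.card_eq_one]
  rfl

/-- Nonemptiness is essential: an empty set in the middle breaks transitivity of `Successive`. -/
theorem successive_of_lt {k : ℕ} {F : ℕ → Finset ℕ+} (hne : ∀ i < k, (F i).Nonempty)
    (hF : ∀ i, i + 1 < k → Successive (F i) (F (i + 1))) {i j : ℕ} (hij : i < j) (hj : j < k) :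
    Successive (F i) (F j) := by
  induction j, hij using Nat.le_induction with
  | base => exact hF i hj
  | succ j hij ih =>
    intro a ha b hb
    obtain ⟨c, hc⟩ := hne j (by omega)
    exact (ih (by omega) a ha c hc).trans (hF j hj c hc b hb)

/-- A set belongs to `𝓢ₙ₊₁` exactly when it is the union of a list of successive, possibly empty,
sets of `𝓢ₙ` whose length is at most each of its elements. -/
theorem mem_succ_iff {n : ℕ} {E : Finset ℕ+} :
    E ∈ schreierFamily (n + 1) ↔ ∃ L : List (Finset ℕ+), L.Pairwise Successive ∧
      (∀ A ∈ L, A ∈ schreierFamily n) ∧ (∀ a ∈ E, L.length ≤ (a : ℕ)) ∧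
      ∀ a, a ∈ E ↔ ∃ A ∈ L, a ∈ A := by
  constructor
  · rintro (rfl | ⟨k, F, hk, hF, hs, hmin, rfl⟩)
    · exact ⟨[], by simp⟩
    · refine ⟨(List.range k).map F, ?_, ?_, ?_, by simp⟩
      · rw [List.pairwise_map]
        refine (List.pairwise_lt_range (n := k)).imp_of_mem fun {i j} _ hj hij => ?_
        exact successive_of_lt (fun i hi => (hF i hi).2) hs hij (List.mem_range.1 hj)
      · simp only [List.mem_map, List.mem_range]
        rintro _ ⟨i, hi, rfl⟩
        exact (hF i hi).1
      · intro a ha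
        simp only [Finset.mem_biUnion, Finset.mem_range] at ha
        obtain ⟨i, hi, ha⟩ := ha
        rw [List.length_map, List.length_range]
        obtain ⟨b, hb⟩ := (hF 0 hk).2
        rcases Nat.eq_zero_or_pos i with rfl | h0
        · exact hmin a ha
        · exact (hmin b hb).trans
            (successive_of_lt (fun i hi => (hF i hi).2) hs h0 hi b hb a ha).le
  · rintro ⟨L, hL, hmem, hmin, hE⟩
    rcases E.eq_empty_or_nonempty with rfl | ⟨e, he⟩
    · exact Or.inl rfl
    -- The definition demands nonempty pieces; discarding empty ones only shortens the list.
    set L' := L.filter (fun A => A ≠ ∅) with hL'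
    have hE' : ∀ a, a ∈ E ↔ ∃ A ∈ L', a ∈ A := by
      intro a
      rw [hE]
      refine exists_congr fun A => ?_
      simp only [hL', List.mem_filter, decide_eq_true_eq]
      exact ⟨fun h => ⟨⟨h.1, Finset.ne_empty_of_mem h.2⟩, h.2⟩, fun h => ⟨h.1.1, h.2⟩⟩
    have hP : L'.Pairwise Successive := hL.filter _
    have hget : ∀ i (hi : i < L'.length), L'.getD i ∅ = L'[i] := fun i hi => by
      simp [List.getD_eq_getElem?_getD, hi]
    have hmem' : ∀ A ∈ L', A ∈ schreierFamily n ∧ A.Nonempty := by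
      intro A hA
      simp only [hL', List.mem_filter, decide_eq_true_eq] at hA
      exact ⟨hmem A hA.1, Finset.nonempty_iff_ne_empty.2 hA.2⟩
    have hlen : L'.length ≤ L.length := List.length_filter_le _ _
    have hpos : 0 < L'.length := by
      obtain ⟨A, hA, _⟩ := (hE' e).1 he
      exact List.length_pos_of_mem hA
    refine Or.inr ⟨L'.length, fun i => L'.getD i ∅, hpos, ?_, ?_, ?_, ?_⟩
    · intro i hi
      simp only [hget i hi]
      exact hmem' _ (List.getElem_mem hi)
    · intro i hi
      simp only [hget i (by omega), hget _ hi]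
      exact List.pairwise_iff_getElem.1 hP i (i + 1) _ _ (Nat.lt_succ_self i)
    · intro a ha
      simp only [hget 0 hpos] at ha
      exact hlen.trans (hmin a ((hE' a).2 ⟨_, List.getElem_mem hpos, ha⟩))
    · ext a
      rw [hE', Finset.mem_biUnion]
      constructor
      · rintro ⟨A, hA, ha⟩
        obtain ⟨i, hi, rfl⟩ := List.getElem_of_mem hA
        exact ⟨i, Finset.mem_range.2 hi, by rwa [hget i hi]⟩
      · rintro ⟨i, hi, ha⟩
        rw [Finset.mem_range] at hi
        rw [hget i hi] at ha
        exact ⟨_, List.getElem_mem hi, ha⟩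

/-- Heredity: intersect every piece with `E`. Some pieces may become empty, which `mem_succ_iff`
allows. -/
theorem mem_of_subset {n : ℕ} {E F : Finset ℕ+} (hF : F ∈ schreierFamily n) (h : E ⊆ F) :
    E ∈ schreierFamily n := by
  classical
  induction n generalizing E F with
  | zero => exact mem_zero_iff.2 ((Finset.card_le_card h).trans (mem_zero_iff.1 hF))
  | succ n ih =>
    obtain ⟨L, hL, hmem, hmin, hE⟩ := mem_succ_iff.1 hF
    refine mem_succ_iff.2 ⟨L.map (· ∩ E), ?_, ?_, ?_, ?_⟩
    · rw [List.pairwise_map]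
      exact hL.imp fun hs a ha b hb =>
        hs a (Finset.mem_of_mem_inter_left ha) b (Finset.mem_of_mem_inter_left hb)
    · simp only [List.mem_map]
      rintro _ ⟨A, hA, rfl⟩
      exact ih (hmem A hA) Finset.inter_subset_left
    · intro a ha
      simpa using hmin a (h ha)
    · intro a
      simp only [List.mem_map, exists_exists_and_eq_and, Finset.mem_inter]
      constructor
      · intro ha
        obtain ⟨A, hA, haA⟩ := (hE a).1 (h ha)
        exact ⟨A, hA, haA, ha⟩
      · rintro ⟨_, _, _, ha⟩
        exact ha

/-- The Schreier families are spreading. -/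
theorem map_mem_of_le {n : ℕ} {φ ψ : ℕ+ ↪o ℕ+} (hle : ∀ j, φ j ≤ ψ j) {F : Finset ℕ+}
    (hF : F.map φ.toEmbedding ∈ schreierFamily n) : F.map ψ.toEmbedding ∈ schreierFamily n := by
  classical
  induction n generalizing F with
  | zero =>
    rw [mem_zero_iff, Finset.card_map] at hF ⊢
    exact hF
  | succ n ih =>
    obtain ⟨L, hL, hmem, hmin, hE⟩ := mem_succ_iff.1 hF
    have hpre : ∀ A : Finset ℕ+, (F.filter fun j => φ j ∈ A).map φ.toEmbedding ⊆ A := by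
      intro A a ha
      simp only [Finset.mem_map, Finset.mem_filter] at ha
      obtain ⟨j, ⟨_, hj⟩, rfl⟩ := ha
      exact hj
    refine mem_succ_iff.2
      ⟨L.map fun A => (F.filter fun j => φ j ∈ A).map ψ.toEmbedding, ?_, ?_, ?_, ?_⟩
    · rw [List.pairwise_map]
      refine hL.imp fun hs a ha b hb => ?_
      simp only [Finset.mem_map, Finset.mem_filter] at ha hb
      obtain ⟨i, ⟨_, hi⟩, rfl⟩ := ha
      obtain ⟨j, ⟨_, hj⟩, rfl⟩ := hb
      exact ψ.lt_iff_lt.2 (φ.lt_iff_lt.1 (hs _ hi _ hj))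
    · simp only [List.mem_map]
      rintro _ ⟨A, hA, rfl⟩
      exact ih (mem_of_subset (hmem A hA) (hpre A))
    · intro a ha
      obtain ⟨j, hj, rfl⟩ := Finset.mem_map.1 ha
      rw [List.length_map]
      exact (hmin (φ j) (Finset.mem_map_of_mem _ hj)).trans (hle j)
    · intro a
      simp only [Finset.mem_map, List.mem_map, exists_exists_and_eq_and, Finset.mem_filter]
      constructor
      · rintro ⟨j, hj, rfl⟩
        obtain ⟨A, hA, hjA⟩ := (hE (φ j)).1 (Finset.mem_map_of_mem _ hj)
        exact ⟨A, hA, j, ⟨hj, hjA⟩, rfl⟩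
      · rintro ⟨A, hA, j, ⟨hj, _⟩, rfl⟩
        exact ⟨j, hj, rfl⟩

/-! ### Covering the undoubled set -/

/-- Singletons serve as the pieces. -/
theorem mem_succ_of_card_le {n : ℕ} {E : Finset ℕ+} (h : ∀ a ∈ E, E.card ≤ (a : ℕ)) :
    E ∈ schreierFamily (n + 1) := by
  refine mem_succ_iff.2 ⟨(E.sort (· ≤ ·)).map fun a => {a}, ?_, ?_, by simpa using h, by simp⟩
  · rw [List.pairwise_map]
    refine (E.sortedLT_sort.pairwise).imp fun hab => ?_
    simpa [Successive] using hab
  · simp only [List.mem_map]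
    rintro _ ⟨a, _, rfl⟩
    exact singleton_mem_schreierFamily n a

/-- A list of at most `c * k` successive sets of `𝓢ₙ` with all elements at least `k` can be
regrouped into at most `c` successive sets of `𝓢ₙ₊₁`. -/
theorem exists_regroup {n k : ℕ} (c : ℕ) (L : List (Finset ℕ+)) (hL : L.Pairwise Successive)
    (hmem : ∀ A ∈ L, A ∈ schreierFamily n) (hk : ∀ A ∈ L, ∀ a ∈ A, k ≤ (a : ℕ))
    (hlen : L.length ≤ c * k) :
    ∃ L' : List (Finset ℕ+), L'.length ≤ c ∧ L'.Pairwise Successive ∧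
      (∀ A ∈ L', A ∈ schreierFamily (n + 1)) ∧
      ∀ a, (∃ A ∈ L', a ∈ A) ↔ ∃ A ∈ L, a ∈ A := by
  classical
  induction c generalizing L with
  | zero =>
    have : L = [] := List.length_eq_zero_iff.1 (by simpa using hlen)
    subst this
    exact ⟨[], by simp⟩
  | succ c ih =>
    obtain ⟨L', h1, h2, h3, h4⟩ := ih (L.drop k) (hL.sublist (List.drop_sublist k L))
      (fun A hA => hmem A (List.mem_of_mem_drop hA)) (fun A hA => hk A (List.mem_of_mem_drop hA))
      (by rw [List.length_drop, Nat.sub_le_iff_le_add]; linarith)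
    have hU : ∀ a, a ∈ (L.take k).toFinset.biUnion id ↔ ∃ A ∈ L.take k, a ∈ A := by
      intro a; simp
    have hsplit : ∀ A, A ∈ L ↔ A ∈ L.take k ∨ A ∈ L.drop k := fun A => by
      rw [← List.mem_append, List.take_append_drop]
    -- The first `k` sets merge into one set of `𝓢ₙ₊₁`, since all their elements are at least `k`;
    -- induction handles the rest.
    refine ⟨(L.take k).toFinset.biUnion id :: L', by simpa using h1, ?_, ?_, ?_⟩
    · refine List.pairwise_cons.2 ⟨fun B hB a ha b hb => ?_, h2⟩
      obtain ⟨A, hA, haA⟩ := (hU a).1 ha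
      obtain ⟨B', hB', hbB'⟩ := (h4 b).1 ⟨B, hB, hb⟩
      rw [← List.take_append_drop k L, List.pairwise_append] at hL
      exact hL.2.2 A hA B' hB' a haA b hbB'
    · intro A hA
      rcases List.mem_cons.1 hA with rfl | hA
      · refine mem_succ_iff.2 ⟨L.take k, hL.sublist (List.take_sublist k L),
          fun A hA => hmem A (List.mem_of_mem_take hA), fun a ha => ?_, hU⟩
        obtain ⟨A, hA, haA⟩ := (hU a).1 ha
        exact (List.length_take_le k L).trans (hk A (List.mem_of_mem_take hA) a haA)
      · exact h3 A hA
    · intro a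
      simp only [List.mem_cons, or_and_right, exists_or, exists_eq_left, hU, h4, hsplit]

/-- If the image of `F` under `j ↦ φ (2 * j)` lies in `𝓢ₙ`, then `φ '' F` is covered by `n + 1`
successive sets of `𝓢ₙ`. -/
theorem exists_cover_of_map_double {n : ℕ} {φ ψ : ℕ+ ↪o ℕ+} (hψ : ∀ j, ψ j = φ (2 * j))
    {F : Finset ℕ+} (hF : F.map ψ.toEmbedding ∈ schreierFamily n) :
    ∃ L : List (Finset ℕ+), L.length ≤ n + 1 ∧ L.Pairwise Successive ∧
      (∀ A ∈ L, A ∈ schreierFamily n) ∧ ∀ a, a ∈ F.map φ.toEmbedding ↔ ∃ A ∈ L, a ∈ A := by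
  classical
  induction n generalizing F with
  | zero =>
    refine ⟨[F.map φ.toEmbedding], by simp, by simp, ?_, by simp⟩
    simpa only [List.mem_singleton, forall_eq, mem_zero_iff, Finset.card_map] using hF
  | succ n ih =>
    rcases F.eq_empty_or_nonempty with rfl | hne
    · exact ⟨[], by simp⟩
    set f := F.min' hne with hf
    have hfF : f ∈ F := F.min'_mem hne
    have hfle : ∀ j ∈ F, f ≤ j := fun j hj => F.min'_le j hj
    obtain ⟨L, hL, hmem, hmin, hE⟩ := mem_succ_iff.1 hF
    -- Every `j ≥ 2 * f` has `φ j ≥ φ (2 * f) ≥ L.length`, so the part of `φ(F)` beyond `2 * f` can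
    -- absorb `L.length` sets of `𝓢ₙ` at a time.
    have hk : L.length ≤ (φ (2 * f) : ℕ) := by
      rw [← hψ]; exact hmin _ (Finset.mem_map_of_mem _ hfF)
    have hle : ∀ j : ℕ+, j ≤ φ j := fun j => φ.strictMono.le_apply
    have key : ∀ A ∈ L, ∃ L' : List (Finset ℕ+), L'.length ≤ n + 1 ∧ L'.Pairwise Successive ∧
        (∀ B ∈ L', B ∈ schreierFamily n) ∧
        ∀ a, a ∈ (F.filter fun j => 2 * f ≤ j ∧ ψ j ∈ A).map φ.toEmbedding ↔
          ∃ B ∈ L', a ∈ B := by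
      intro A hA
      refine ih (mem_of_subset (hmem A hA) fun a ha => ?_)
      simp only [Finset.mem_map, Finset.mem_filter] at ha
      obtain ⟨j, ⟨_, _, hj⟩, rfl⟩ := ha
      exact hj
    choose! G hG1 hG2 hG3 hG4 using key
    have hmemG : ∀ a, (∃ B ∈ L.flatMap G, a ∈ B) ↔ ∃ j ∈ F, 2 * f ≤ j ∧ φ j = a := by
      intro a
      simp only [List.mem_flatMap]
      constructor
      · rintro ⟨B, ⟨A, hA, hB⟩, ha⟩
        have := (hG4 A hA a).2 ⟨B, hB, ha⟩
        simp only [Finset.mem_map, Finset.mem_filter] at this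
        obtain ⟨j, ⟨h1, h2, _⟩, rfl⟩ := this
        exact ⟨j, h1, h2, rfl⟩
      · rintro ⟨j, hj, h2, rfl⟩
        obtain ⟨A, hA, hjA⟩ := (hE (ψ j)).1 (Finset.mem_map_of_mem _ hj)
        obtain ⟨B, hB, ha⟩ := (hG4 A hA (φ j)).1
          (Finset.mem_map_of_mem φ.toEmbedding (Finset.mem_filter.2 ⟨hj, h2, hjA⟩))
        exact ⟨B, ⟨A, hA, hB⟩, ha⟩
    -- Each of the `L.length` pieces yields at most `n + 1` sets of `𝓢ₙ`; regrouped by `L.length`,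
    -- they form at most `n + 1` sets of `𝓢ₙ₊₁`.
    obtain ⟨L', h1, h2, h3, h4⟩ := exists_regroup (n := n) (k := L.length) (n + 1) (L.flatMap G)
      (by
        rw [List.pairwise_flatMap]
        refine ⟨hG2, hL.imp_of_mem fun {A B} hA hB hAB C hC D hD a ha b hb => ?_⟩
        have ha' := (hG4 A hA a).2 ⟨C, hC, ha⟩
        have hb' := (hG4 B hB b).2 ⟨D, hD, hb⟩
        simp only [Finset.mem_map, Finset.mem_filter] at ha' hb'
        obtain ⟨i, ⟨_, _, hi⟩, rfl⟩ := ha'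
        obtain ⟨j, ⟨_, _, hj⟩, rfl⟩ := hb'
        exact φ.lt_iff_lt.2 (ψ.lt_iff_lt.1 (hAB _ hi _ hj)))
      (by
        intro B hB
        obtain ⟨A, hA, hB⟩ := List.mem_flatMap.1 hB
        exact hG3 A hA B hB)
      (by
        intro B hB a ha
        obtain ⟨j, _, h2, rfl⟩ := (hmemG a).1 ⟨B, hB, ha⟩
        exact hk.trans (φ.monotone h2))
      (by
        rw [List.length_flatMap, mul_comm]
        calc (L.map fun A => (G A).length).sum ≤ (L.map fun A => (G A).length).length • (n + 1) :=
              List.sum_le_card_nsmul _ _ (by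
                simp only [List.mem_map]
                rintro _ ⟨A, hA, rfl⟩
                exact hG1 A hA)
          _ = L.length * (n + 1) := by simp)
    -- The indices in `[f, 2 * f)` give one further set: at most `f` elements, each at least `f`
    -- because `i ≤ φ i`.
    refine ⟨(F.filter fun j => j < 2 * f).map φ.toEmbedding :: L', by simpa using h1, ?_, ?_, ?_⟩
    · refine List.pairwise_cons.2 ⟨fun B hB a ha b hb => ?_, h2⟩
      obtain ⟨j, _, hj, rfl⟩ := (hmemG b).1 ((h4 b).1 ⟨B, hB, hb⟩)
      simp only [Finset.mem_map, Finset.mem_filter] at ha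
      obtain ⟨i, ⟨_, hi⟩, rfl⟩ := ha
      exact φ.lt_iff_lt.2 (hi.trans_le hj)
    · intro A hA
      rcases List.mem_cons.1 hA with rfl | hA
      · refine mem_succ_of_card_le fun a ha => ?_
        simp only [Finset.mem_map, Finset.mem_filter] at ha
        obtain ⟨i, ⟨hi, _⟩, rfl⟩ := ha
        rw [Finset.card_map]
        have hsub : F.filter (fun j => j < 2 * f) ⊆ Finset.Ico f (2 * f) := fun j hj => by
          rw [Finset.mem_filter] at hj
          exact Finset.mem_Ico.2 ⟨hfle j hj.1, hj.2⟩
        have hcard := Finset.card_le_card hsub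
        rw [PNat.card_Ico, PNat.mul_coe] at hcard
        have h5 : (f : ℕ) ≤ (φ i : ℕ) := (hfle i hi).trans (hle i)
        have h6 : ((2 : ℕ+) : ℕ) = 2 := rfl
        rw [h6] at hcard
        exact le_trans (by omega) h5
      · exact h3 A hA
    · intro a
      simp only [List.mem_cons, or_and_right, exists_or, exists_eq_left, h4, hmemG,
        Finset.mem_map, Finset.mem_filter]
      constructor
      · rintro ⟨j, hj, rfl⟩
        rcases lt_or_ge j (2 * f) with h | h
        · exact Or.inl ⟨j, ⟨hj, h⟩, rfl⟩
        · exact Or.inr ⟨j, hj, h, rfl⟩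
      · rintro (⟨j, ⟨hj, _⟩, rfl⟩ | ⟨j, hj, _, rfl⟩)
        · exact ⟨j, hj, rfl⟩
        · exact ⟨j, hj, rfl⟩

end SchreierFamily

/-! ### Norm estimates along subsequences of the basis -/

namespace SchreierSpace

variable {𝕜 : Type*} [RCLike 𝕜] {n : ℕ}

/-- The linear map `c₀₀ → X[𝓢ₙ]` sending the `j`-th unit vector to `e_{φ j}`. -/
noncomputable def basisMap (𝕜 : Type*) [RCLike 𝕜] (n : ℕ) (φ : ℕ+ ↪o ℕ+) :
    (ℕ+ →₀ 𝕜) →ₗ[𝕜] SchreierSpace 𝕜 n :=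
  (UniformSpace.Completion.toComplL (𝕜 := 𝕜) (E := SchreierC00 𝕜 n)).toLinearMap ∘ₗ
    SchreierC00.toFinsupp.symm.toLinearMap ∘ₗ Finsupp.lmapDomain 𝕜 𝕜 φ

theorem norm_basisMap (φ : ℕ+ ↪o ℕ+) (x : ℕ+ →₀ 𝕜) :
    ‖basisMap 𝕜 n φ x‖ = ⨆ E : SchreierSet n, ∑ j ∈ E.1, ‖x.mapDomain φ j‖ :=
  UniformSpace.Completion.norm_coe (E := SchreierC00 𝕜 n) _

theorem basisMap_single (φ : ℕ+ ↪o ℕ+) (j : ℕ+) (c : 𝕜) :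
    basisMap 𝕜 n φ (Finsupp.single j c) = c • schreierBasis 𝕜 n (φ j) := by
  have h : Finsupp.single j c = c • Finsupp.single j (1 : 𝕜) := by simp
  rw [h, map_smul]
  congr 1
  change ((SchreierC00.toFinsupp.symm ((Finsupp.single j (1 : 𝕜)).mapDomain φ) :
    SchreierC00 𝕜 n) : UniformSpace.Completion (SchreierC00 𝕜 n)) = _
  rw [Finsupp.mapDomain_single]
  rfl

theorem sum_le_norm_basisMap {φ : ℕ+ ↪o ℕ+} {G : Finset ℕ+}
    (hG : G.map φ.toEmbedding ∈ schreierFamily n) (x : ℕ+ →₀ 𝕜) :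
    ∑ j ∈ G, ‖x j‖ ≤ ‖basisMap 𝕜 n φ x‖ := by
  rcases G.eq_empty_or_nonempty with rfl | hne
  · simp
  have h := SchreierC00.sum_le_schreierNorm (n := n) (SchreierC00.toFinsupp.symm (x.mapDomain φ))
    ⟨G.map φ.toEmbedding, hG, hne.map⟩
  rw [Finset.sum_map] at h
  rw [norm_basisMap]
  refine le_trans (Finset.sum_le_sum fun j _ => ?_) h
  exact (congrArg norm (Finsupp.mapDomain_apply φ.injective x j)).ge

/-- By heredity any test set may be cut down to the range of `φ`, outside which the coordinates
vanish. -/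
theorem norm_basisMap_le {φ : ℕ+ ↪o ℕ+} {x : ℕ+ →₀ 𝕜} {B : ℝ}
    (h : ∀ G : Finset ℕ+, G.map φ.toEmbedding ∈ schreierFamily n → ∑ j ∈ G, ‖x j‖ ≤ B) :
    ‖basisMap 𝕜 n φ x‖ ≤ B := by
  classical
  rw [norm_basisMap]
  refine ciSup_le fun E => ?_
  set G := E.1.preimage φ φ.injective.injOn with hG
  have hsub : G.map φ.toEmbedding ⊆ E.1 := by
    intro a ha
    obtain ⟨j, hj, rfl⟩ := Finset.mem_map.1 ha
    exact Finset.mem_preimage.1 hj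
  refine le_trans (le_of_eq ?_) (h G (SchreierFamily.mem_of_subset E.2.1 hsub))
  rw [← Finset.sum_subset hsub, Finset.sum_map]
  · exact Finset.sum_congr rfl fun j _ => congrArg norm (Finsupp.mapDomain_apply φ.injective x j)
  · intro a haE ha
    rw [Finsupp.mapDomain_of_notMem_range, norm_zero]
    rintro ⟨j, rfl⟩
    exact ha (Finset.mem_map_of_mem φ.toEmbedding (Finset.mem_preimage.2 haE))

theorem norm_basisMap_le_of_le {φ ψ : ℕ+ ↪o ℕ+} (hle : ∀ j, φ j ≤ ψ j) (x : ℕ+ →₀ 𝕜) :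
    ‖basisMap 𝕜 n φ x‖ ≤ ‖basisMap 𝕜 n ψ x‖ :=
  norm_basisMap_le fun _ hG => sum_le_norm_basisMap (SchreierFamily.map_mem_of_le hle hG) x

theorem norm_basisMap_double_le {φ ψ : ℕ+ ↪o ℕ+} (hψ : ∀ j, ψ j = φ (2 * j)) (x : ℕ+ →₀ 𝕜) :
    ‖basisMap 𝕜 n ψ x‖ ≤ (n + 1) * ‖basisMap 𝕜 n φ x‖ := by
  classical
  refine norm_basisMap_le fun G hG => ?_
  obtain ⟨L, hlen, -, hmem, hcov⟩ := SchreierFamily.exists_cover_of_map_double hψ hG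
  -- Each `j ∈ G` is counted at least once among the covering sets.
  calc ∑ j ∈ G, ‖x j‖ ≤ ∑ j ∈ G, ∑ A ∈ L.toFinset, if φ j ∈ A then ‖x j‖ else 0 := by
        refine Finset.sum_le_sum fun j hj => ?_
        obtain ⟨A, hA, hjA⟩ := (hcov (φ j)).1 (Finset.mem_map_of_mem φ.toEmbedding hj)
        refine (if_pos hjA).ge.trans (Finset.single_le_sum
          (f := fun A => if φ j ∈ A then ‖x j‖ else 0) (fun B _ => ?_) (List.mem_toFinset.2 hA))
        split_ifs <;> simp
    _ = ∑ A ∈ L.toFinset, ∑ j ∈ G with φ j ∈ A, ‖x j‖ := by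
        rw [Finset.sum_comm]
        simp only [Finset.sum_filter]
    _ ≤ ∑ _A ∈ L.toFinset, ‖basisMap 𝕜 n φ x‖ := by
        refine Finset.sum_le_sum fun A hA => sum_le_norm_basisMap ?_ x
        refine SchreierFamily.mem_of_subset (hmem A (List.mem_toFinset.1 hA)) fun a ha => ?_
        obtain ⟨j, hj, rfl⟩ := Finset.mem_map.1 ha
        exact (Finset.mem_filter.1 hj).2
    _ = L.toFinset.card * ‖basisMap 𝕜 n φ x‖ := by rw [Finset.sum_const, nsmul_eq_mul]
    _ ≤ (n + 1) * ‖basisMap 𝕜 n φ x‖ := by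
        refine mul_le_mul_of_nonneg_right ?_ (norm_nonneg _)
        exact_mod_cast (List.toFinset_card_le L).trans hlen

theorem basisMap_mapDomain (φ σ : ℕ+ ↪o ℕ+) (x : ℕ+ →₀ 𝕜) :
    basisMap 𝕜 n φ (x.mapDomain σ) = basisMap 𝕜 n (σ.trans φ) x := by
  change basisMap 𝕜 n φ (Finsupp.lmapDomain 𝕜 𝕜 σ x) = _
  rw [← LinearMap.comp_apply]
  congr 1
  ext j
  simp [basisMap_single]

/-- Precomposing with an index map does not increase the norm of the coefficients it retains. -/
theorem norm_basisMap_le_of_comp {φ σ : ℕ+ ↪o ℕ+} (hσ : ∀ j, j ≤ σ j) {x y : ℕ+ →₀ 𝕜}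
    (h : ∀ j, y (σ j) = x j) : ‖basisMap 𝕜 n φ x‖ ≤ ‖basisMap 𝕜 n φ y‖ := by
  refine norm_basisMap_le fun G hG => ?_
  have hG' : (G.map σ.toEmbedding).map φ.toEmbedding ∈ schreierFamily n := by
    rw [Finset.map_map]
    exact SchreierFamily.map_mem_of_le (ψ := σ.trans φ) (fun j => φ.monotone (hσ j)) hG
  have := sum_le_norm_basisMap hG' y
  rw [Finset.sum_map] at this
  exact le_trans (Finset.sum_le_sum fun j _ => (congrArg norm (h j)).ge) this

/-! ### Interleaving and its two-sided bounds -/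

/-- The index map `j ↦ 2 * j`. -/
def evenIndex : ℕ+ ↪o ℕ+ :=
  OrderEmbedding.ofStrictMono (fun j => 2 * j) fun _ _ h => mul_lt_mul_right h 2

/-- The index map `j ↦ 2 * j - 1`. -/
def oddIndex : ℕ+ ↪o ℕ+ :=
  OrderEmbedding.ofStrictMono (fun j => (2 * (j : ℕ) - 1).toPNat (by have := j.pos; omega)) fun i j h => by
    have h' : (i : ℕ) < j := h
    have := i.pos
    change 2 * (i : ℕ) - 1 < 2 * (j : ℕ) - 1
    omega

theorem coe_evenIndex (j : ℕ+) : (evenIndex j : ℕ) = 2 * j := rfl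

theorem coe_oddIndex (j : ℕ+) : (oddIndex j : ℕ) = 2 * (j : ℕ) - 1 := rfl

theorem oddIndex_ne_evenIndex (i j : ℕ+) : oddIndex i ≠ evenIndex j := by
  intro h
  have := congrArg PNat.val h
  have h1 := coe_evenIndex j
  have h2 := coe_oddIndex i
  have := i.pos
  omega

theorem exists_eq_evenIndex_or_oddIndex (k : ℕ+) :
    (∃ j, evenIndex j = k) ∨ ∃ j, oddIndex j = k := by
  have hk := k.pos
  rcases Nat.even_or_odd' k with ⟨c, hc | hc⟩
  · exact Or.inl ⟨c.toPNat (by omega), PNat.eq ((coe_evenIndex _).trans hc.symm)⟩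
  · refine Or.inr ⟨(c + 1).toPNat (by omega), PNat.eq ((coe_oddIndex _).trans ?_)⟩
    rw [hc]
    change 2 * (c + 1) - 1 = 2 * c + 1
    omega

/-- Interleaving two finitely supported sequences. -/
noncomputable def interleave (𝕜 : Type*) [RCLike 𝕜] :
    ((ℕ+ →₀ 𝕜) × (ℕ+ →₀ 𝕜)) →ₗ[𝕜] (ℕ+ →₀ 𝕜) :=
  (Finsupp.lmapDomain 𝕜 𝕜 evenIndex).coprod (Finsupp.lmapDomain 𝕜 𝕜 oddIndex)

theorem interleave_apply (p : (ℕ+ →₀ 𝕜) × (ℕ+ →₀ 𝕜)) :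
    interleave 𝕜 p = p.1.mapDomain evenIndex + p.2.mapDomain oddIndex := rfl

theorem interleave_evenIndex (p : (ℕ+ →₀ 𝕜) × (ℕ+ →₀ 𝕜)) (j : ℕ+) :
    interleave 𝕜 p (evenIndex j) = p.1 j := by
  rw [interleave_apply, Finsupp.add_apply, Finsupp.mapDomain_apply evenIndex.injective,
    Finsupp.mapDomain_of_notMem_range, add_zero]
  rintro ⟨i, hi⟩
  exact oddIndex_ne_evenIndex i j hi

theorem interleave_oddIndex (p : (ℕ+ →₀ 𝕜) × (ℕ+ →₀ 𝕜)) (j : ℕ+) :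
    interleave 𝕜 p (oddIndex j) = p.2 j := by
  rw [interleave_apply, Finsupp.add_apply, Finsupp.mapDomain_apply oddIndex.injective,
    Finsupp.mapDomain_of_notMem_range, zero_add]
  rintro ⟨i, hi⟩
  exact oddIndex_ne_evenIndex j i hi.symm

theorem interleave_bijective : Function.Bijective (interleave 𝕜) := by
  constructor
  · intro p q h
    refine Prod.ext (Finsupp.ext fun j => ?_) (Finsupp.ext fun j => ?_)
    · rw [← interleave_evenIndex, h, interleave_evenIndex]
    · rw [← interleave_oddIndex, h, interleave_oddIndex]
  · intro x
    refine ⟨(x.comapDomain evenIndex evenIndex.injective.injOn,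
      x.comapDomain oddIndex oddIndex.injective.injOn), Finsupp.ext fun k => ?_⟩
    rcases exists_eq_evenIndex_or_oddIndex k with ⟨j, rfl⟩ | ⟨j, rfl⟩
    · rw [interleave_evenIndex, Finsupp.comapDomain_apply]
    · rw [interleave_oddIndex, Finsupp.comapDomain_apply]

theorem norm_fst_le_norm_interleave (φ : ℕ+ ↪o ℕ+) (p : (ℕ+ →₀ 𝕜) × (ℕ+ →₀ 𝕜)) :
    ‖basisMap 𝕜 n φ p.1‖ ≤ ‖basisMap 𝕜 n φ (interleave 𝕜 p)‖ :=
  norm_basisMap_le_of_comp (fun _ => evenIndex.strictMono.le_apply) (interleave_evenIndex p)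

theorem norm_snd_le_norm_interleave (φ : ℕ+ ↪o ℕ+) (p : (ℕ+ →₀ 𝕜) × (ℕ+ →₀ 𝕜)) :
    ‖basisMap 𝕜 n φ p.2‖ ≤ ‖basisMap 𝕜 n φ (interleave 𝕜 p)‖ :=
  norm_basisMap_le_of_comp (fun _ => oddIndex.strictMono.le_apply) (interleave_oddIndex p)

theorem norm_interleave_le (φ : ℕ+ ↪o ℕ+) (p : (ℕ+ →₀ 𝕜) × (ℕ+ →₀ 𝕜)) :
    ‖basisMap 𝕜 n φ (interleave 𝕜 p)‖ ≤
      (n + 1) * ‖basisMap 𝕜 n φ p.1‖ + (n + 1) * ‖basisMap 𝕜 n φ p.2‖ := by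
  have hdbl : ∀ j, evenIndex.trans φ j = φ (2 * j) := fun _ => rfl
  have hle : ∀ j, oddIndex.trans φ j ≤ evenIndex.trans φ j := fun j =>
    φ.monotone (show 2 * (j : ℕ) - 1 ≤ 2 * (j : ℕ) from Nat.sub_le _ _)
  have h1 := norm_basisMap_double_le (n := n) hdbl p.1
  have h2 := (norm_basisMap_le_of_le (n := n) hle p.2).trans (norm_basisMap_double_le hdbl p.2)
  rw [interleave_apply, map_add, basisMap_mapDomain, basisMap_mapDomain]
  exact (norm_add_le _ _).trans (add_le_add h1 h2)

/-! ### Passage to closed spans -/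

theorem range_basisMap (φ : ℕ+ ↪o ℕ+) :
    LinearMap.range (basisMap 𝕜 n φ) =
      Submodule.span 𝕜 (schreierBasis 𝕜 n '' Set.range φ) := by
  apply le_antisymm
  · rintro _ ⟨x, rfl⟩
    induction x using Finsupp.induction_linear with
    | zero => simp
    | add x y hx hy => rw [map_add]; exact add_mem hx hy
    | single j c =>
      rw [basisMap_single]
      exact Submodule.smul_mem _ _ (Submodule.subset_span ⟨φ j, ⟨j, rfl⟩, rfl⟩)
  · rw [Submodule.span_le]
    rintro _ ⟨_, ⟨j, rfl⟩, rfl⟩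
    exact ⟨Finsupp.single j 1, by rw [basisMap_single, one_smul]⟩

/-- The map `basisMap`, with values in the closed span of the `e_{φ j}`. -/
noncomputable def basisMapSubspace (𝕜 : Type*) [RCLike 𝕜] (n : ℕ) (φ : ℕ+ ↪o ℕ+) :
    (ℕ+ →₀ 𝕜) →ₗ[𝕜] schreierSubspace 𝕜 n (Set.range φ) :=
  (basisMap 𝕜 n φ).codRestrict _ fun x =>
    Submodule.le_topologicalClosure _ ((range_basisMap (𝕜 := 𝕜) (n := n) φ).le ⟨x, rfl⟩)

theorem denseRange_basisMapSubspace (φ : ℕ+ ↪o ℕ+) :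
    DenseRange (basisMapSubspace 𝕜 n φ) := by
  intro y
  rw [closure_subtype, ← Set.range_comp]
  have h : Set.range (Subtype.val ∘ basisMapSubspace 𝕜 n φ) =
      (Submodule.span 𝕜 (schreierBasis 𝕜 n '' Set.range φ) : Set (SchreierSpace 𝕜 n)) := by
    rw [← range_basisMap]
    rfl
  rw [h]
  exact y.2

theorem exists_orderEmbedding_range_eq {M : Set ℕ+} (hM : M.Infinite) :
    ∃ φ : ℕ+ ↪o ℕ+, Set.range φ = M := by
  classical
  let e : ℕ+ ≃o ℕ := OrderIso.pnatIsoNat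
  have := (hM.image e.injective.injOn).to_subtype
  refine ⟨(e.toOrderEmbedding.trans (Nat.orderEmbeddingOfSet (e '' M))).trans
    e.symm.toOrderEmbedding, ?_⟩
  calc Set.range (e.symm ∘ Nat.orderEmbeddingOfSet (e '' M) ∘ e)
      = e.symm '' (e '' M) := by
        rw [Set.range_comp, EquivLike.range_comp, Nat.orderEmbeddingOfSet_range]
    _ = M := by simp [Set.image_image]

end SchreierSpace

open SchreierSpace in
theorem mainTheorem5 (𝕜 : Type*) [RCLike 𝕜] (n : ℕ) (hn : 1 ≤ n) (M : Set ℕ+) (hM : M.Infinite) :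
    Nonempty (schreierSubspace 𝕜 n M ≃L[𝕜] (schreierSubspace 𝕜 n M × schreierSubspace 𝕜 n M)) := by
  obtain ⟨φ, rfl⟩ := exists_orderEmbedding_range_eq hM
  have : CompleteSpace (schreierSubspace 𝕜 n (Set.range φ)) :=
    (Submodule.isClosed_topologicalClosure _).completeSpace_coe
  have hd := denseRange_basisMapSubspace (𝕜 := 𝕜) (n := n) φ
  let T := LinearEquiv.ofBijective (interleave 𝕜) interleave_bijective
  -- The product carries the max norm, so the two summands of `norm_interleave_le` give `2 * (n +
  -- 1)`, while the inverse has bound `1`.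
  refine ⟨(T.extend ((basisMapSubspace 𝕜 n φ).prodMap (basisMapSubspace 𝕜 n φ))
    (basisMapSubspace 𝕜 n φ) (hd.prodMap hd) ⟨2 * (n + 1), fun p => ?_⟩ hd
    ⟨1, fun x => ?_⟩).symm⟩
  · have h1 : ‖basisMap 𝕜 n φ p.1‖ ≤
        ‖(basisMapSubspace 𝕜 n φ).prodMap (basisMapSubspace 𝕜 n φ) p‖ := le_max_left _ _
    have h2 : ‖basisMap 𝕜 n φ p.2‖ ≤
        ‖(basisMapSubspace 𝕜 n φ).prodMap (basisMapSubspace 𝕜 n φ) p‖ := le_max_right _ _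
    refine (norm_interleave_le φ p).trans ?_
    rw [← mul_add, mul_comm 2, mul_assoc]
    exact mul_le_mul_of_nonneg_left (by linarith) (by positivity)
  · obtain ⟨p, rfl⟩ := T.surjective x
    rw [T.symm_apply_apply, one_mul]
    exact max_le (norm_fst_le_norm_interleave φ p) (norm_snd_le_norm_interleave φ p)
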